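/- **Setting.** Fix $d\ge 1$, $\gamma\in(1,\infty]$, $\tau\in(2,3)$, $C,w_0>0$, and put $\mu=w_0\frac{\tau-1}{\tau-2}$ and $C_1=(1+(\gamma-1)^{-1})2^d$ (with $1/\infty=0$). For every $n$ let $V=[n]$, let $V_C=\{1,\dots,k\}$ with $k=k(n)\le n$, and let $w_1,\dots,w_n>0$ be deterministic weights (which may depend on $n$). Let $F_n(x)=\frac1n\#\{i\in V: w_i\le x\}$ and $F_k(x)=\frac1k\#\{i\in V_C: w_i\le x\}$. As $n\to\infty$, assume that 1. $1-F_n(x)=Cx^{1-\tau}(1+o(1))$ uniformly over $w_0\le x\le n^{1/(\tau-1)}/\log n$; 2. $1-F_k(x)=Cx^{1-\tau}(1+o(1))$ uniformly over $w_0\le x\le A\,k^{1/(\tau-1)}/\log k$, for every constant $A>0$; 3. the vertices beyond the range of (1) have total weight $\sum_{i:\,w_i>n^{1/(\tau-1)}/\log n}w_i=O(n)$. Under $H_0$, the edges $\{i,j\}$ of the random simple graph $G$ on $V$ are present independently with probabilities $\min\left(\frac{w_iw_j}{\mu n},1\right)$. Under $H_1$, the vertices $i\in V_C$ have independent uniform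 positions $x_i$ in the torus $(\mathbb R/\mathbb Z)^d$, with $\|x-y\|$ the maximum over the coordinates of the circle distance $\min_{m\in\mathbb Z}|x(l)-y(l)-m|$. Given the positions, the edges are present independently, with probability $\frac{1}{1+C_1}\min\left(\frac{w_iw_j}{\mu k\|x_i-x_j\|^d},1\right)^{\gamma}$ if $i,j\in V_C$, and with probability $\frac1{1+C_1}\min\left(\frac{w_iw_j}{\mu n},1\right)$ otherwise. For $\gamma=\infty$ the first of these is read as $\frac1{1+C_1}$ if $\|x_i-x_j\|^d\le \frac{w_iw_j}{\mu k}$, and $0$ otherwise. Write $P_0,P_1$ for the probabilities under $H_0,H_1$. **Theorem 3.1.** Let $f(n)\to\infty$ with $f(n)=o(k(n))$ as $n\to\infty$. Let $$W(G)=\sum_{a,b,c\in V}\frac{1}{w_aw_bw_c}\mathbf 1\{a,b,c\text{ form a triangle in }G\}$$ (a sum over ordered triples). The weighted triangle test, which rejects $H_0$ if and only if $W(G)\ge f(n)$, is asymptotically powerful, that is, $$\lim_{n\to\infty}\Big(P_0\big(W(G)\ge f(n)\big)+P_1\big(W(G)<f(n)\big)\Big)=0 .$$ -/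

import Mathlib

open Filter Topology MeasureTheory Asymptotics
open scoped ENNReal

noncomputable section

namespace GeoCommunity

/-! ### Weight sequences -/

/-- The proportion of indices in `S` whose weight is at most `x` (empirical distribution function
of the weights in `S`). -/
def empiricalCDF {n : ℕ} (w : Fin n → ℝ) (S : Finset (Fin n)) (x : ℝ) : ℝ :=
  ((S.filter fun i => w i ≤ x).card : ℝ) / (S.card : ℝ)

/-- The community `V_C`, consisting of the first `k` of the `n` vertices. -/
def community (n k : ℕ) : Finset (Fin n) := Finset.univ.filter fun i => i.val < k

/-- The natural cutoff `m ^ (1 / (τ - 1)) / log m` for `m` power-law weights. -/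
def cutoff (τ : ℝ) (m : ℕ) : ℝ := (m : ℝ) ^ (1 / (τ - 1)) / Real.log (m : ℝ)

/-- `1 - F_n(x) = C x ^ (1 - τ) (1 + o(1))` as `n → ∞`, uniformly over `w₀ ≤ x ≤ b n`. -/
def HasPowerLawTail (τ C w₀ : ℝ) (F : ℕ → ℝ → ℝ) (b : ℕ → ℝ) : Prop :=
  ∀ ε : ℝ, 0 < ε → ∀ᶠ n in atTop, ∀ x : ℝ, w₀ ≤ x → x ≤ b n →
    |(1 - F n x) - C * x ^ (1 - τ)| ≤ ε * (C * x ^ (1 - τ))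

/-- The weights of all `n` vertices have a power-law tail, for `w₀ ≤ x ≤ n^(1/(τ-1)) / log n`. -/
def PowerLawWeights (τ C w₀ : ℝ) (w : (n : ℕ) → Fin n → ℝ) : Prop :=
  HasPowerLawTail τ C w₀ (fun n => empiricalCDF (w n) Finset.univ) (fun n => cutoff τ n)

/-- The weights of the `k n` community vertices have a power-law tail with the same constants,
for `w₀ ≤ x = O(k^(1/(τ-1)) / log k)`. -/
def PowerLawCommunityWeights (τ C w₀ : ℝ) (k : ℕ → ℕ) (w : (n : ℕ) → Fin n → ℝ) : Prop :=
  ∀ A : ℝ, 0 < A →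
    HasPowerLawTail τ C w₀ (fun n => empiricalCDF (w n) (community n (k n)))
      (fun n => A * cutoff τ (k n))

/-- The total weight of the vertices that lie beyond the range `x ≤ n^(1/(τ-1)) / log n`. -/
def excessWeight (τ : ℝ) {n : ℕ} (w : Fin n → ℝ) : ℝ :=
  ∑ i ∈ Finset.univ.filter (fun i => cutoff τ n < w i), w i

/-! ### Random graphs with conditionally independent edges -/

/-- The probability of the graph `G` when each edge `{i, j}`, `i < j`, is present with probability
`p i j`, independently of all other edges. -/
def graphMass {n : ℕ} (p : Fin n → Fin n → ℝ) (G : SimpleGraph (Fin n)) : ℝ :=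
  open Classical in
  ∏ e ∈ Finset.univ.filter (fun e : Fin n × Fin n => e.1 < e.2),
    if G.Adj e.1 e.2 then p e.1 e.2 else 1 - p e.1 e.2

/-- The probability of the event `A` for a graph with independent edges. -/
def graphProb {n : ℕ} (p : Fin n → Fin n → ℝ) (A : Set (SimpleGraph (Fin n))) : ℝ :=
  open Classical in
  ∑ G ∈ Finset.univ.filter (fun G : SimpleGraph (Fin n) => G ∈ A), graphMass p G

/-- The constant `μ = w₀ (τ - 1) / (τ - 2)`. -/
def meanWeight (τ w₀ : ℝ) : ℝ := w₀ * ((τ - 1) / (τ - 2))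

/-- Connection probability of the inhomogeneous random graph. -/
def irgEdge (μ : ℝ) {n : ℕ} (w : Fin n → ℝ) (i j : Fin n) : ℝ :=
  min (w i * w j / (μ * n)) 1

/-- `min (s / r, 1) ^ γ`, where `s / 0 = ∞`, and where for `γ = ∞` this is
the indicator of `r ≤ s` (for `s > 0` and `r ≥ 0`). -/
def kernel (γ : ℝ≥0∞) (s r : ℝ) : ℝ :=
  if r = 0 then 1
  else if γ = ⊤ then (if r ≤ s then 1 else 0)
  else (min (s / r) 1) ^ γ.toReal

/-- The constant `C₁ = (1 + (γ - 1)⁻¹) 2 ^ d`, with `∞⁻¹ = 0`. -/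
def corrConst (d : ℕ) (γ : ℝ≥0∞) : ℝ := (1 + ((γ - 1)⁻¹).toReal) * 2 ^ d

/-- Edge probabilities of the alternative model on `n` vertices, given the positions `x` of the
community vertices in the torus `(ℝ / ℤ) ^ d`. The norm on `UnitAddTorus (Fin d)` is the maximum
over the coordinates of the distance to the nearest integer. -/
def altEdge (d : ℕ) (γ : ℝ≥0∞) (μ : ℝ) {n : ℕ} (k : ℕ) (w : Fin n → ℝ)
    (x : Fin k → UnitAddTorus (Fin d)) (i j : Fin n) : ℝ :=
  1 / (1 + corrConst d γ) *
    if h : i.val < k ∧ j.val < k then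
      kernel γ (w i * w j) (μ * k * ‖x ⟨i.val, h.1⟩ - x ⟨j.val, h.2⟩‖ ^ d)
    else irgEdge μ w i j

/-- The probability `P₀(A)` under the null hypothesis. -/
def nullProb (μ : ℝ) {n : ℕ} (w : Fin n → ℝ) (A : Set (SimpleGraph (Fin n))) : ℝ :=
  graphProb (irgEdge μ w) A

/-- The probability `P₁(A)` under the alternative hypothesis: the positions of the `k` community
vertices are independent and uniform on the torus, and given the positions the edges are
independent. -/
def altProb (d : ℕ) (γ : ℝ≥0∞) (μ : ℝ) {n : ℕ} (k : ℕ) (w : Fin n → ℝ)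
    (A : Set (SimpleGraph (Fin n))) : ℝ :=
  ∫ x : Fin k → UnitAddTorus (Fin d), graphProb (altEdge d γ μ k w x) A

/-! ### Tests -/

/-- The weighted triangle statistic: the sum of `1 / (w_a w_b w_c)` over all ordered triples
`(a, b, c)` that form a triangle. -/
def weightedTriangles {n : ℕ} (w : Fin n → ℝ) (G : SimpleGraph (Fin n)) : ℝ :=
  open Classical in
  ∑ a, ∑ b, ∑ c, if G.Adj a b ∧ G.Adj b c ∧ G.Adj c a then 1 / (w a * w b * w c) else 0

/-- The weighted triangle test with threshold `t`; the value `1` means that the null hypothesis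
is rejected. -/
def weightedTriangleTest {n : ℕ} (w : Fin n → ℝ) (t : ℝ) (G : SimpleGraph (Fin n)) : Fin 2 :=
  open Classical in
  if t ≤ weightedTriangles w G then 1 else 0

/-- The risk of a test: the sum of its type-I and type-II error probabilities. -/
def risk (d : ℕ) (γ : ℝ≥0∞) (μ : ℝ) {n : ℕ} (k : ℕ) (w : Fin n → ℝ)
    (ψ : SimpleGraph (Fin n) → Fin 2) : ℝ :=
  nullProb μ w {G | ψ G = 1} + altProb d γ μ k w {G | ψ G = 0}

/-- A sequence of tests is asymptotically powerful if its risk vanishes. -/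
def AsymptoticallyPowerful (d : ℕ) (γ : ℝ≥0∞) (μ : ℝ) (k : ℕ → ℕ) (w : (n : ℕ) → Fin n → ℝ)
    (ψ : (n : ℕ) → SimpleGraph (Fin n) → Fin 2) : Prop :=
  Tendsto (fun n => risk d γ μ (k n) (w n) (ψ n)) atTop (𝓝 0)

end GeoCommunity

end

/-! Under the null hypothesis the factor `1 / (w_a w_b w_c)` cancels the weights in the product of
the three edge probabilities up to a factor `w_a w_b w_c / (μ n) ^ 3`, so `W` has expectation at most
`((∑ w) / (μ n)) ^ 3 = O(1)`, and Markov's inequality bounds the type-I error.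

Under the alternative, a positive fraction of the community has weight of order one; split these
vertices into three groups of the same size. Place a grid of order `k` disjoint balls of volume of
order `1 / k` in the torus. The balls are so small that any two vertices of the groups in the same
ball are joined with probability `1 / (1 + C₁)`. The events that a ball contains a vertex of each
group have probability bounded below and are negatively correlated: inside one group, the
probability of missing two disjoint balls is at most the product of the probabilities of missing
each. By Chebyshev's inequality, of order `k` balls are occupied in this sense. One triple of
vertices from each of them gives possible triangles without common edges, which are present
independently with constant probability, and a second use of Chebyshev's inequality shows that `W`
is at least of order `k`. -/

namespace GeoCommunity

open ProbabilityTheory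

/-! ### The second moment method -/

section SecondMoment

variable {Ω κ : Type*} [MeasurableSpace Ω] {P : Measure Ω} [IsProbabilityMeasure P]

lemma memLp_indicator_one {A : Set Ω} (hA : MeasurableSet A) :
    MemLp (A.indicator (1 : Ω → ℝ)) 2 P :=
  memLp_indicator_const 2 hA 1 (.inr (measure_ne_top _ _))

lemma covariance_indicator_one {A B : Set Ω} (hA : MeasurableSet A) (hB : MeasurableSet B) :
    cov[A.indicator 1, B.indicator 1; P] = P.real (A ∩ B) - P.real A * P.real B := by
  rw [covariance_eq_sub (memLp_indicator_one hA) (memLp_indicator_one hB),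
    ← Set.inter_indicator_one, integral_indicator_one hA,
    integral_indicator_one hB, integral_indicator_one (hA.inter hB)]

lemma variance_sum_indicator_le {J : Finset κ} {A : κ → Set Ω} (hA : ∀ j ∈ J, MeasurableSet (A j))
    (hneg : ∀ i ∈ J, ∀ j ∈ J, i ≠ j → P.real (A i ∩ A j) ≤ P.real (A i) * P.real (A j)) :
    Var[∑ j ∈ J, (A j).indicator 1; P] ≤ ∑ j ∈ J, P.real (A j) := by
  classical
  rw [variance_sum' fun j hj => memLp_indicator_one (hA j hj)]
  refine Finset.sum_le_sum fun i hi => ?_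
  calc ∑ j ∈ J, cov[(A i).indicator 1, (A j).indicator 1; P]
      ≤ ∑ j ∈ J, if i = j then P.real (A i) else 0 := by
        refine Finset.sum_le_sum fun j hj => ?_
        rw [covariance_indicator_one (hA i hi) (hA j hj)]
        split_ifs with hij
        · subst hij
          rw [Set.inter_self]
          exact sub_le_self _ (by positivity)
        · exact sub_nonpos.2 (hneg i hi j hj hij)
    _ = P.real (A i) := by rw [Finset.sum_ite_eq, if_pos hi]

lemma measureReal_card_lt_half_le {J : Finset κ} {A : κ → Set Ω} (hA : ∀ j ∈ J, MeasurableSet (A j))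
    (hneg : ∀ i ∈ J, ∀ j ∈ J, i ≠ j → P.real (A i ∩ A j) ≤ P.real (A i) * P.real (A j))
    {e : ℝ} (he : 0 < e) (heJ : e ≤ ∑ j ∈ J, P.real (A j)) :
    P.real {ω | open Classical in ((J.filter fun j => ω ∈ A j).card : ℝ) < e / 2} ≤ 4 / e := by
  classical
  set N : Ω → ℝ := ∑ j ∈ J, (A j).indicator 1
  have hmem : ∀ j ∈ J, MemLp ((A j).indicator (1 : Ω → ℝ)) 2 P := fun j hj =>
    memLp_indicator_one (hA j hj)
  have hN : MemLp N 2 P := memLp_finsetSum' _ hmem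
  have hcard : ∀ ω, N ω = (J.filter fun j => ω ∈ A j).card := fun ω => by
    simp [N, Finset.sum_apply, Set.indicator_apply]
  set m := ∑ j ∈ J, P.real (A j)
  have hmean : P[N] = m := by
    simp only [N, Finset.sum_apply]
    rw [integral_finsetSum _ fun j hj => (hmem j hj).integrable (by norm_num)]
    exact Finset.sum_congr rfl fun j hj => integral_indicator_one (hA j hj)
  have hm : 0 < m := he.trans_le heJ
  calc P.real {ω | ((J.filter fun j => ω ∈ A j).card : ℝ) < e / 2}
      ≤ P.real {ω | m / 2 ≤ |N ω - P[N]|} := by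
        refine measureReal_mono fun ω hω => ?_
        rw [Set.mem_ofPred_eq, ← hcard] at hω
        rw [Set.mem_ofPred_eq, hmean, abs_sub_comm]
        linarith [le_abs_self (m - N ω)]
    _ ≤ Var[N; P] / (m / 2) ^ 2 :=
        ENNReal.toReal_le_of_le_ofReal (by positivity [variance_nonneg N P])
          (meas_ge_le_variance_div_sq hN (by positivity))
    _ ≤ m / (m / 2) ^ 2 := by gcongr; exact variance_sum_indicator_le hA hneg
    _ = 4 / m := by field_simp; norm_num
    _ ≤ 4 / e := by gcongr

end SecondMoment

/-! ### Cells that contain a point of each group -/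

lemma iIndep_biSup_of_pairwise_disjoint {Ω ι κ : Type*} {m : ι → MeasurableSpace Ω}
    {mΩ : MeasurableSpace Ω} {P : Measure Ω} (hm : ∀ i, m i ≤ mΩ) (hind : iIndep m P)
    {S : κ → Set ι} (hS : Pairwise (Function.onFun Disjoint S)) :
    iIndep (fun g => ⨆ i ∈ S g, m i) P := by
  classical
  have := hind.isProbabilityMeasure
  refine (iIndep_iff _ P).2 fun s A hA => ?_
  induction s using Finset.induction_on with
  | empty => simp
  | insert g s hg ih =>
    have hdisj : Disjoint (S g) (⋃ h ∈ s, S h) :=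
      Set.disjoint_iUnion₂_right.2 fun h hh => hS (by rintro rfl; exact hg hh)
    have hrest : MeasurableSet[⨆ i ∈ ⋃ h ∈ s, S h, m i] (⋂ h ∈ s, A h) :=
      s.measurableSet_biInter fun h hh =>
        (biSup_mono fun i hi => Set.mem_biUnion hh hi :
          ⨆ i ∈ S h, m i ≤ ⨆ i ∈ ⋃ h ∈ s, S h, m i) _ (hA h (Finset.mem_insert_of_mem hh))
    rw [Finset.set_biInter_insert, Finset.prod_insert hg,
      (Indep_iff _ _ P).1 (indep_iSup_of_disjoint hm hind hdisj) _ _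
        (hA g (Finset.mem_insert_self g s)) hrest,
      ih fun h hh => hA h (Finset.mem_insert_of_mem hh)]

section Hit

variable {ι κ E : Type*}

/-- The configurations `x` of points that have a point `x a`, `a ∈ S`, in `B`. -/
def hitSet (S : Finset ι) (B : Set E) : Set (ι → E) := {x | ∃ a ∈ S, x a ∈ B}

lemma compl_hitSet (S : Finset ι) (B : Set E) :
    (hitSet S B)ᶜ = (S : Set ι).pi fun _ => Bᶜ := by
  ext x; simp [hitSet]

lemma hitSet_eq_biUnion (S : Finset ι) (B : Set E) :
    hitSet S B = ⋃ a ∈ S, Function.eval a ⁻¹' B := by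
  ext x; simp [hitSet]

variable [MeasurableSpace E]

lemma measurableSet_hitSet_biSup (S : Finset ι) {B : Set E} (hB : MeasurableSet B) :
    MeasurableSet[⨆ a ∈ (S : Set ι), MeasurableSpace.comap (Function.eval a) inferInstance]
      (hitSet S B) := by
  rw [hitSet_eq_biUnion]
  exact S.measurableSet_biUnion fun a ha =>
    le_biSup (fun a => MeasurableSpace.comap (Function.eval a) inferInstance)
      (Finset.mem_coe.2 ha) _ ⟨B, hB, rfl⟩

lemma measurableSet_hitSet (S : Finset ι) {B : Set E} (hB : MeasurableSet B) :
    MeasurableSet (hitSet S B) := by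
  rw [hitSet_eq_biUnion]
  exact S.measurableSet_biUnion fun a _ => measurable_pi_apply a hB

variable [Fintype ι] {P : Measure E} [IsProbabilityMeasure P]

lemma measureReal_compl_hitSet (S : Finset ι) (B : Set E) :
    (Measure.pi fun _ : ι => P).real (hitSet S B)ᶜ = P.real Bᶜ ^ S.card := by
  rw [compl_hitSet, measureReal_def, Measure.pi_pi_finset]
  simp [measureReal_def]

lemma measureReal_hitSet (S : Finset ι) {B : Set E} (hB : MeasurableSet B) :
    (Measure.pi fun _ : ι => P).real (hitSet S B) = 1 - (1 - P.real B) ^ S.card := by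
  rw [← probReal_compl_eq_one_sub hB, ← measureReal_compl_hitSet,
    probReal_compl_eq_one_sub (measurableSet_hitSet S hB), sub_sub_cancel]

lemma measureReal_iInter_hitSet_groups [Fintype κ] {S : κ → Finset ι}
    (hS : Pairwise (Function.onFun Disjoint S)) {A : κ → Set (ι → E)}
    (hA : ∀ g, MeasurableSet[⨆ a ∈ (S g : Set ι),
      MeasurableSpace.comap (Function.eval a) inferInstance] (A g)) :
    (Measure.pi fun _ : ι => P).real (⋂ g, A g) =
      ∏ g, (Measure.pi fun _ : ι => P).real (A g) := by
  have hind := iIndep_biSup_of_pairwise_disjoint (S := fun g => (S g : Set ι))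
    (fun a => (measurable_pi_apply a).comap_le)
    (iIndepFun_pi (μ := fun _ : ι => P) (X := fun _ => id) fun _ => aemeasurable_id).iIndep
    fun g h hgh => Finset.disjoint_coe.2 (hS hgh)
  simpa only [measureReal_def, ENNReal.toReal_prod] using congrArg ENNReal.toReal
    (hind.meas_iInter hA)

lemma measureReal_inter_le_mul_of_compl {Ω : Type*} [MeasurableSpace Ω] {Q : Measure Ω}
    [IsProbabilityMeasure Q] {A B : Set Ω} (hA : MeasurableSet A) (hB : MeasurableSet B)
    (h : Q.real (Aᶜ ∩ Bᶜ) ≤ Q.real Aᶜ * Q.real Bᶜ) : Q.real (A ∩ B) ≤ Q.real A * Q.real B := by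
  have hunion := measureReal_union_add_inter (μ := Q) (s := Aᶜ) hB.compl
  rw [← Set.compl_inter] at hunion
  simp only [probReal_compl_eq_one_sub, hA, hB, hA.inter hB] at h hunion
  linarith

lemma measureReal_hitSet_inter_le (S : Finset ι) {B B' : Set E} (hB : MeasurableSet B)
    (hB' : MeasurableSet B') (hBB' : Disjoint B B') :
    (Measure.pi fun _ : ι => P).real (hitSet S B ∩ hitSet S B') ≤
      (Measure.pi fun _ : ι => P).real (hitSet S B) *
        (Measure.pi fun _ : ι => P).real (hitSet S B') := by
  refine measureReal_inter_le_mul_of_compl (measurableSet_hitSet S hB)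
    (measurableSet_hitSet S hB') ?_
  have hcompl : (hitSet S B : Set (ι → E))ᶜ ∩ (hitSet S B')ᶜ = (hitSet S (B ∪ B'))ᶜ := by
    simp only [compl_hitSet, Set.compl_union, Set.pi_inter_distrib]
  have hunion : P.real (B ∪ B')ᶜ ≤ P.real Bᶜ * P.real B'ᶜ := by
    rw [probReal_compl_eq_one_sub (hB.union hB'), probReal_compl_eq_one_sub hB,
      probReal_compl_eq_one_sub hB', measureReal_union hBB' hB']
    linarith [mul_nonneg (measureReal_nonneg (μ := P) (s := B))
      (measureReal_nonneg (μ := P) (s := B'))]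
  rw [hcompl, measureReal_compl_hitSet, measureReal_compl_hitSet, measureReal_compl_hitSet,
    ← mul_pow]
  gcongr

lemma measureReal_iInter_hitSet [Fintype κ] {S : κ → Finset ι}
    (hS : Pairwise (Function.onFun Disjoint S)) {B : Set E} (hB : MeasurableSet B) :
    (Measure.pi fun _ : ι => P).real (⋂ g, hitSet (S g) B) =
      ∏ g, (1 - (1 - P.real B) ^ (S g).card) := by
  rw [measureReal_iInter_hitSet_groups hS fun g => measurableSet_hitSet_biSup _ hB]
  exact Finset.prod_congr rfl fun g _ => measureReal_hitSet (S g) hB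

lemma measureReal_iInter_hitSet_inter_le [Finite κ] {S : κ → Finset ι}
    (hS : Pairwise (Function.onFun Disjoint S)) {B B' : Set E} (hB : MeasurableSet B)
    (hB' : MeasurableSet B') (hBB' : Disjoint B B') :
    (Measure.pi fun _ : ι => P).real ((⋂ g, hitSet (S g) B) ∩ ⋂ g, hitSet (S g) B') ≤
      (Measure.pi fun _ : ι => P).real (⋂ g, hitSet (S g) B) *
        (Measure.pi fun _ : ι => P).real (⋂ g, hitSet (S g) B') := by
  cases nonempty_fintype κ
  have hm := fun g => measurableSet_hitSet_biSup (S g) hB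
  have hm' := fun g => measurableSet_hitSet_biSup (S g) hB'
  rw [← Set.iInter_inter_distrib, measureReal_iInter_hitSet_groups hS fun g => (hm g).inter (hm' g),
    measureReal_iInter_hitSet_groups hS hm, measureReal_iInter_hitSet_groups hS hm',
    ← Finset.prod_mul_distrib]
  exact Finset.prod_le_prod (fun _ _ => measureReal_nonneg)
    fun g _ => measureReal_hitSet_inter_le (S g) hB hB' hBB'

end Hit

/-! ### A grid of disjoint balls in the torus -/

section Torus

variable {ι : Type*} [Fintype ι]

instance : IsProbabilityMeasure (volume : Measure (UnitAddTorus ι)) :=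
  ⟨by simp [volume_pi, Measure.pi_univ]⟩

/-- The grid point with coordinates `j i / L` in the torus. -/
noncomputable def torusGrid (L : ℕ) (j : ι → Fin L) : UnitAddTorus ι :=
  fun i => ((j i / L : ℝ) : UnitAddCircle)

/-- The cells `torusCell L j` are pairwise disjoint balls of diameter at most `1 / (2L)`, which
together cover a fixed proportion of the torus. -/
def torusCell (L : ℕ) (j : ι → Fin L) : Set (UnitAddTorus ι) :=
  Metric.closedBall (torusGrid L j) (1 / (4 * L))

lemma one_div_le_norm_coe_div_sub {L a b : ℕ} (ha : a < L) (hb : b < L) (hab : a ≠ b) :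
    1 / (L : ℝ) ≤ ‖((a / L : ℝ) : UnitAddCircle) - ((b / L : ℝ) : UnitAddCircle)‖ := by
  wlog h : b < a
  · rw [norm_sub_rev]
    exact this hb ha hab.symm (by lia)
  have hnorm := AddCircle.norm_div_natCast (p := (1 : ℝ)) (m := a - b) (n := L)
  rw [mul_one, one_mul, Nat.mod_eq_of_lt (by lia)] at hnorm
  rw [← AddCircle.coe_sub, ← sub_div, ← Nat.cast_sub h.le, hnorm]
  gcongr
  exact_mod_cast (by lia : 1 ≤ min (a - b) (L - (a - b)))

lemma pairwise_disjoint_torusCell {L : ℕ} :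
    Pairwise (Function.onFun Disjoint (torusCell (ι := ι) L)) := by
  intro j j' hjj'
  obtain ⟨i, hi⟩ := Function.ne_iff.1 hjj'
  have hL : (0 : ℝ) < L := Nat.cast_pos.2 (j i).pos
  refine Metric.closedBall_disjoint_closedBall ?_
  calc 1 / (4 * L : ℝ) + 1 / (4 * L) < 1 / L := by
        field_simp
        norm_num
    _ ≤ ‖torusGrid L j i - torusGrid L j' i‖ :=
        one_div_le_norm_coe_div_sub (j i).2 (j' i).2 (Fin.val_injective.ne hi)
    _ ≤ dist (torusGrid L j) (torusGrid L j') := by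
        rw [dist_eq_norm]
        exact norm_le_pi_norm (torusGrid L j - torusGrid L j') i

lemma norm_sub_le_of_mem_torusCell {L : ℕ} {j : ι → Fin L} {x y : UnitAddTorus ι}
    (hx : x ∈ torusCell L j) (hy : y ∈ torusCell L j) : ‖x - y‖ ≤ 1 / (2 * L) := by
  rw [← dist_eq_norm]
  refine (dist_triangle_right x y _).trans ((add_le_add hx hy).trans_eq ?_)
  field_simp
  norm_num

lemma measurableSet_torusCell {L : ℕ} (j : ι → Fin L) : MeasurableSet (torusCell L j) :=
  Metric.isClosed_closedBall.measurableSet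

lemma volume_torusCell {L : ℕ} (hL : 0 < L) (j : ι → Fin L) :
    volume.real (torusCell L j) = (1 / (2 * L)) ^ Fintype.card ι := by
  have hL' : (1 : ℝ) ≤ L := by exact_mod_cast hL
  have hdiam : 2 * (1 / (4 * L : ℝ)) = 1 / (2 * L) := by
    field_simp
    norm_num
  have hle : 1 / (2 * L : ℝ) ≤ 1 := by
    rw [div_le_one (by positivity)]
    linarith
  rw [torusCell, closedBall_pi _ (by positivity), volume_pi, measureReal_def, Measure.pi_pi]
  simp only [AddCircle.volume_closedBall, hdiam, min_eq_right hle, Finset.prod_const,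
    Finset.card_univ, ENNReal.toReal_pow]
  rw [ENNReal.toReal_ofReal (by positivity)]

end Torus

/-! ### Graphs with independent edges -/

section GraphMeasure

variable {n : ℕ} {p : Fin n → Fin n → ℝ}

/-- The law of the random graph in which the edges are present independently of each other, the
edge `{i, j}` with probability `p i j`. It turns `graphProb` into the measure of an event, see
`graphProb_eq_measureReal`. -/
noncomputable def graphMeasure (p : Fin n → Fin n → ℝ) : Measure (SimpleGraph (Fin n)) :=
  ∑ G, ENNReal.ofReal (graphMass p G) • Measure.dirac G

instance {V : Type*} [Finite V] : DiscreteMeasurableSpace (SimpleGraph V) where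
  forall_measurableSet A := by
    rw [← SimpleGraph.measurableEmbedding_edgeSet.measurableSet_image]
    exact .of_discrete

lemma graphMass_nonneg (hp : ∀ i j, p i j ∈ Set.Icc 0 1) (G : SimpleGraph (Fin n)) :
    0 ≤ graphMass p G :=
  Finset.prod_nonneg fun e _ => by
    split_ifs
    · exact (hp _ _).1
    · exact sub_nonneg.2 (hp _ _).2

lemma graphProb_nonneg (hp : ∀ i j, p i j ∈ Set.Icc 0 1)
    (A : Set (SimpleGraph (Fin n))) : 0 ≤ graphProb p A :=
  Finset.sum_nonneg fun G _ => graphMass_nonneg hp G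

lemma graphProb_eq_measureReal (hp : ∀ i j, p i j ∈ Set.Icc 0 1)
    (A : Set (SimpleGraph (Fin n))) : graphProb p A = (graphMeasure p).real A := by
  classical
  simp only [graphMeasure, measureReal_def, Measure.coe_finsetSum, Finset.sum_apply,
    Measure.smul_apply, Measure.dirac_apply, smul_eq_mul]
  rw [ENNReal.toReal_sum fun G _ => ENNReal.mul_ne_top ENNReal.ofReal_ne_top
    (by by_cases hG : G ∈ A <;> simp [hG]), graphProb, Finset.sum_filter]
  refine Finset.sum_congr rfl fun G _ => ?_
  by_cases hG : G ∈ A <;> simp [hG, ENNReal.toReal_ofReal (graphMass_nonneg hp G)]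

lemma graphMass_eq_prod_sym2 (hp : ∀ i j, p i j = p j i) (G : SimpleGraph (Fin n)) :
    graphMass p G = open Classical in ∏ e : Sym2 (Fin n) with ¬ e.IsDiag,
      if e ∈ G.edgeSet then Sym2.lift ⟨p, hp⟩ e else 1 - Sym2.lift ⟨p, hp⟩ e := by
  classical
  refine Finset.prod_nbij (fun e => s(e.1, e.2)) ?_ ?_ ?_ fun _ _ => by simp
  · simpa using fun i j h => h.ne
  · rintro ⟨a, b⟩ hab ⟨c, d⟩ hcd h
    simp only [Finset.coe_filter, Finset.mem_univ, true_and, Set.mem_ofPred_eq] at hab hcd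
    rcases Sym2.eq_iff.1 h with ⟨rfl, rfl⟩ | ⟨rfl, rfl⟩
    · rfl
    · exact absurd hab hcd.asymm
  · intro e he
    induction e with
    | h a b =>
      rcases lt_or_gt_of_ne (by simpa using he : a ≠ b) with h | h
      · exact ⟨(a, b), by simpa using h, rfl⟩
      · exact ⟨(b, a), by simpa using h, Sym2.eq_swap⟩

lemma sum_simpleGraph_eq_sum_powerset {M : Type*} [AddCommMonoid M]
    (F : Finset (Sym2 (Fin n)) → M) :
    open Classical in ∑ G : SimpleGraph (Fin n), F G.edgeFinset =
      ∑ E ∈ ({e | ¬ e.IsDiag} : Finset (Sym2 (Fin n))).powerset, F E := by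
  classical
  refine Finset.sum_bij' (fun G _ => G.edgeFinset) (fun E _ => SimpleGraph.fromEdgeSet E)
    (fun G _ => ?_) (fun _ _ => Finset.mem_univ _) (fun G _ => by simp) (fun E hE => ?_)
    fun _ _ => rfl
  · exact Finset.mem_powerset.2 fun e he =>
      by simpa using G.not_isDiag_of_mem_edgeFinset he
  · ext e
    have : e ∈ E → ¬ e.IsDiag := fun he => by simpa using Finset.mem_powerset.1 hE he
    simpa using this

lemma graphProb_subset_edgeSet (hp : ∀ i j, p i j = p j i) {F : Finset (Sym2 (Fin n))}
    (hF : ∀ e ∈ F, ¬ e.IsDiag) :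
    graphProb p {G | ↑F ⊆ G.edgeSet} = ∏ e ∈ F, Sym2.lift ⟨p, hp⟩ e := by
  classical
  set P := Sym2.lift ⟨p, hp⟩
  set D : Finset (Sym2 (Fin n)) := {e | ¬ e.IsDiag}
  have hFD : F ⊆ D := fun e he => by simpa [D] using hF e he
  calc graphProb p {G | ↑F ⊆ G.edgeSet}
      = ∑ G : SimpleGraph (Fin n), ∏ e ∈ D,
          if e ∈ G.edgeFinset then P e else if e ∈ F then 0 else 1 - P e := by
        rw [graphProb, Finset.sum_filter]
        refine Finset.sum_congr rfl fun G _ => ?_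
        split_ifs with hG
        · rw [graphMass_eq_prod_sym2 hp]
          refine Finset.prod_congr rfl fun e _ => ?_
          have : e ∈ F → e ∈ G.edgeSet := fun he => hG he
          grind [SimpleGraph.mem_edgeFinset]
        · obtain ⟨e, heF, heG⟩ := Set.not_subset.1 hG
          refine (Finset.prod_eq_zero (i := e) (hFD heF) ?_).symm
          rw [if_neg (by simpa using heG), if_pos (by simpa using heF)]
    _ = ∏ e ∈ D, (P e + if e ∈ F then 0 else 1 - P e) := by
        rw [Finset.prod_add, sum_simpleGraph_eq_sum_powerset fun E => ∏ e ∈ D,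
          if e ∈ E then P e else if e ∈ F then 0 else 1 - P e]
        refine Finset.sum_congr rfl fun E hE => ?_
        rw [Finset.prod_ite, Finset.filter_mem_eq_inter, Finset.filter_notMem_eq_sdiff,
          Finset.inter_eq_right.2 (Finset.mem_powerset.1 hE)]
    _ = ∏ e ∈ D, (if e ∈ F then P e else 1) :=
        Finset.prod_congr rfl fun e _ => by split_ifs <;> ring
    _ = ∏ e ∈ F, P e := by rw [Finset.prod_ite_mem, Finset.inter_eq_right.2 hFD]

lemma isProbabilityMeasure_graphMeasure (hp : ∀ i j, p i j = p j i)
    (hp' : ∀ i j, p i j ∈ Set.Icc 0 1) : IsProbabilityMeasure (graphMeasure p) := by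
  have h : (graphMeasure p).real Set.univ = 1 := by
    rw [← graphProb_eq_measureReal hp']
    simpa using graphProb_subset_edgeSet hp (F := ∅) (by simp)
  exact ⟨by simpa [measureReal_def, ENNReal.toReal_eq_one_iff] using h⟩

lemma graphProb_le_one (hp : ∀ i j, p i j = p j i) (hp' : ∀ i j, p i j ∈ Set.Icc 0 1)
    (A : Set (SimpleGraph (Fin n))) : graphProb p A ≤ 1 := by
  have := isProbabilityMeasure_graphMeasure hp hp'
  rw [graphProb_eq_measureReal hp']
  exact measureReal_le_one

lemma measureReal_subset_edgeSet (hp : ∀ i j, p i j = p j i)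
    (hp' : ∀ i j, p i j ∈ Set.Icc 0 1) {F : Finset (Sym2 (Fin n))} (hF : ∀ e ∈ F, ¬ e.IsDiag) :
    (graphMeasure p).real {G | ↑F ⊆ G.edgeSet} = ∏ e ∈ F, Sym2.lift ⟨p, hp⟩ e := by
  rw [← graphProb_eq_measureReal hp', graphProb_subset_edgeSet hp hF]

lemma measureReal_subset_edgeSet_inter (hp : ∀ i j, p i j = p j i)
    (hp' : ∀ i j, p i j ∈ Set.Icc 0 1) {F F' : Finset (Sym2 (Fin n))} (hF : ∀ e ∈ F, ¬ e.IsDiag)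
    (hF' : ∀ e ∈ F', ¬ e.IsDiag) (hFF' : Disjoint F F') :
    (graphMeasure p).real ({G | ↑F ⊆ G.edgeSet} ∩ {G | ↑F' ⊆ G.edgeSet}) =
      (graphMeasure p).real {G | ↑F ⊆ G.edgeSet} * (graphMeasure p).real {G | ↑F' ⊆ G.edgeSet} := by
  classical
  have hunion : {G : SimpleGraph (Fin n) | ↑F ⊆ G.edgeSet} ∩ {G | ↑F' ⊆ G.edgeSet} =
      {G | ↑(F ∪ F') ⊆ G.edgeSet} := by
    ext G
    simp [Set.union_subset_iff]
  rw [hunion, measureReal_subset_edgeSet hp hp' hF, measureReal_subset_edgeSet hp hp' hF',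
    measureReal_subset_edgeSet hp hp' fun e he => (Finset.mem_union.1 he).elim (hF e) (hF' e),
    Finset.prod_union hFF']

end GraphMeasure

section Triangles

variable {V : Type*}

/-- The event that `a`, `b` and `c` form a triangle. -/
def triangleEvent (a b c : V) : Set (SimpleGraph V) := {G | G.Adj a b ∧ G.Adj b c ∧ G.Adj c a}

variable [DecidableEq V]

/-- The edges of the triangle with vertices `a`, `b` and `c`. -/
def triangleEdges (a b c : V) : Finset (Sym2 V) := {s(a, b), s(b, c), s(c, a)}

lemma triangleEvent_eq (a b c : V) :
    triangleEvent a b c = {G | ↑(triangleEdges a b c) ⊆ G.edgeSet} := by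
  ext G
  simp [triangleEvent, triangleEdges, Set.insert_subset_iff]

lemma not_isDiag_of_mem_triangleEdges {a b c : V} (hab : a ≠ b) (hbc : b ≠ c) (hca : c ≠ a) :
    ∀ e ∈ triangleEdges a b c, ¬ e.IsDiag := by
  simp [triangleEdges, hab, hbc, hca]

lemma disjoint_triangleEdges {v v' : Fin 3 → V} (h : ∀ g g', v g ≠ v' g') :
    Disjoint (triangleEdges (v 0) (v 1) (v 2)) (triangleEdges (v' 0) (v' 1) (v' 2)) := by
  have h' : ∀ g g', v' g' ≠ v g := fun g g' => (h g g').symm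
  simp [triangleEdges, h']

variable {n : ℕ} {p : Fin n → Fin n → ℝ}

lemma measureReal_triangleEvent (hp : ∀ i j, p i j = p j i) (hp' : ∀ i j, p i j ∈ Set.Icc 0 1)
    {a b c : Fin n} (hab : a ≠ b) (hbc : b ≠ c) (hca : c ≠ a) :
    (graphMeasure p).real (triangleEvent a b c) = p a b * p b c * p c a := by
  rw [triangleEvent_eq,
    measureReal_subset_edgeSet hp hp' (not_isDiag_of_mem_triangleEdges hab hbc hca), triangleEdges,
    Finset.prod_insert (by simp [hab, hbc, hca.symm]),
    Finset.prod_insert (by simp [hbc, hab.symm]), Finset.prod_singleton, mul_assoc]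
  rfl

lemma measureReal_triangleEvent_inter (hp : ∀ i j, p i j = p j i)
    (hp' : ∀ i j, p i j ∈ Set.Icc 0 1) {v v' : Fin 3 → Fin n} (hv : Function.Injective v)
    (hv' : Function.Injective v') (hvv' : ∀ g g', v g ≠ v' g') :
    (graphMeasure p).real
        (triangleEvent (v 0) (v 1) (v 2) ∩ triangleEvent (v' 0) (v' 1) (v' 2)) =
      (graphMeasure p).real (triangleEvent (v 0) (v 1) (v 2)) *
        (graphMeasure p).real (triangleEvent (v' 0) (v' 1) (v' 2)) := by
  simp only [triangleEvent_eq]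
  exact measureReal_subset_edgeSet_inter hp hp'
    (not_isDiag_of_mem_triangleEdges (hv.ne (by decide)) (hv.ne (by decide)) (hv.ne (by decide)))
    (not_isDiag_of_mem_triangleEdges (hv'.ne (by decide)) (hv'.ne (by decide))
      (hv'.ne (by decide)))
    (disjoint_triangleEdges hvv')

end Triangles

section WeightedTriangles

variable {n : ℕ} {p : Fin n → Fin n → ℝ} {w : Fin n → ℝ}

lemma weightedTriangles_eq_sum_indicator (w : Fin n → ℝ) (G : SimpleGraph (Fin n)) :
    weightedTriangles w G = ∑ a, ∑ b, ∑ c,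
      1 / (w a * w b * w c) * (triangleEvent a b c).indicator 1 G := by
  classical
  simp [weightedTriangles, triangleEvent, Set.indicator_apply]

lemma weightedTriangles_nonneg (hw : ∀ i, 0 < w i) (G : SimpleGraph (Fin n)) :
    0 ≤ weightedTriangles w G :=
  Finset.sum_nonneg fun a _ => Finset.sum_nonneg fun b _ => Finset.sum_nonneg fun c _ => by
    have := hw a
    have := hw b
    have := hw c
    split_ifs <;> positivity

lemma card_triangles_div_le_weightedTriangles {κ : Type*} [Fintype κ] (hw : ∀ i, 0 < w i) {M : ℝ}
    {v : κ × Fin 3 → Fin n} (hv : Function.Injective v) (hvM : ∀ i, w (v i) ≤ M)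
    (G : SimpleGraph (Fin n)) :
    open Classical in ((Finset.univ.filter fun j =>
      G ∈ triangleEvent (v (j, 0)) (v (j, 1)) (v (j, 2))).card : ℝ) / M ^ 3 ≤
        weightedTriangles w G := by
  classical
  set T : κ → Fin n × Fin n × Fin n := fun j => (v (j, 0), v (j, 1), v (j, 2))
  have hT : Function.Injective T := fun i j hij => congrArg Prod.fst (hv (congrArg Prod.fst hij))
  set term : Fin n × Fin n × Fin n → ℝ := fun t =>
    if G ∈ triangleEvent t.1 t.2.1 t.2.2 then 1 / (w t.1 * w t.2.1 * w t.2.2) else 0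
  have hterm : ∀ t, 0 ≤ term t := fun t => by
    have := hw t.1
    have := hw t.2.1
    have := hw t.2.2
    positivity
  have hM : ∀ j, w (v (j, 0)) * w (v (j, 1)) * w (v (j, 2)) ≤ M ^ 3 := fun j => by
    have h := fun g => (hw (v (j, g))).le
    have hM0 := (h 0).trans (hvM (j, 0))
    rw [pow_three']
    exact mul_le_mul (mul_le_mul (hvM _) (hvM _) (h 1) hM0) (hvM _) (h 2) (mul_nonneg hM0 hM0)
  calc _ = ∑ j, if G ∈ triangleEvent (v (j, 0)) (v (j, 1)) (v (j, 2)) then 1 / M ^ 3 else 0 := by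
        rw [← Finset.sum_filter, Finset.sum_const, nsmul_eq_mul, mul_one_div]
    _ ≤ ∑ j, term (T j) := by
        refine Finset.sum_le_sum fun j _ => ?_
        simp only [term, T]
        split_ifs
        · exact one_div_le_one_div_of_le (mul_pos (mul_pos (hw _) (hw _)) (hw _)) (hM j)
        · exact le_rfl
    _ ≤ ∑ t, term t := by
        rw [← Finset.sum_image fun i _ j _ h => hT h]
        exact Finset.sum_le_sum_of_subset_of_nonneg (Finset.subset_univ _) fun t _ _ => hterm t
    _ = weightedTriangles w G := by
        simp [term, weightedTriangles, Fintype.sum_prod_type, triangleEvent]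

lemma graphProb_weightedTriangles_lt_le {κ : Type*} [Fintype κ] [Nonempty κ]
    (hp : ∀ i j, p i j = p j i) (hp' : ∀ i j, p i j ∈ Set.Icc 0 1) (hw : ∀ i, 0 < w i) {M q t : ℝ}
    {v : κ × Fin 3 → Fin n} (hv : Function.Injective v) (hvM : ∀ i, w (v i) ≤ M)
    (hvq : ∀ j g h, g ≠ h → p (v (j, g)) (v (j, h)) = q) (hq : 0 < q)
    (ht : M ^ 3 * t ≤ Fintype.card κ * q ^ 3 / 2) :
    graphProb p {G | weightedTriangles w G < t} ≤ 4 / (Fintype.card κ * q ^ 3) := by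
  classical
  have := isProbabilityMeasure_graphMeasure hp hp'
  set A : κ → Set (SimpleGraph (Fin n)) := fun j =>
    triangleEvent (v (j, 0)) (v (j, 1)) (v (j, 2))
  have hvj : ∀ j, Function.Injective fun g => v (j, g) := fun j g h hgh =>
    congrArg Prod.snd (hv hgh)
  have hA : ∀ j, (graphMeasure p).real (A j) = q ^ 3 := fun j => by
    have hne : ∀ g h, g ≠ h → v (j, g) ≠ v (j, h) := fun _ _ => (hvj j).ne
    rw [measureReal_triangleEvent hp hp' (hne 0 1 (by decide)) (hne 1 2 (by decide))
      (hne 2 0 (by decide)), hvq j 0 1 (by decide), hvq j 1 2 (by decide), hvq j 2 0 (by decide)]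
    ring
  have hcard : ∑ j, (graphMeasure p).real (A j) = Fintype.card κ * q ^ 3 := by simp [hA]
  have hM : 0 < M := (hw _).trans_le (hvM (Classical.arbitrary _))
  rw [graphProb_eq_measureReal hp']
  refine (measureReal_mono fun G hG => ?_).trans (measureReal_card_lt_half_le (J := Finset.univ)
    (fun j _ => .of_discrete) (fun i _ j _ hij => ?_) (by positivity) hcard.ge)
  · have h := (card_triangles_div_le_weightedTriangles hw hv hvM G).trans_lt hG
    rw [div_lt_iff₀' (by positivity)] at h
    exact h.trans_le ht
  · exact (measureReal_triangleEvent_inter hp hp' (hvj i) (hvj j) fun g h hgh =>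
      hij (congrArg Prod.fst (hv hgh))).le

end WeightedTriangles

/-! ### The null hypothesis -/

section Null

variable {μ : ℝ} {n : ℕ} {w : Fin n → ℝ}

lemma irgEdge_comm (μ : ℝ) (w : Fin n → ℝ) (i j : Fin n) :
    irgEdge μ w i j = irgEdge μ w j i := by
  rw [irgEdge, irgEdge, mul_comm (w i)]

lemma irgEdge_mem_Icc (hμ : 0 ≤ μ) (hw : ∀ i, 0 < w i) (i j : Fin n) :
    irgEdge μ w i j ∈ Set.Icc 0 1 :=
  ⟨le_min (div_nonneg (mul_pos (hw i) (hw j)).le (by positivity)) zero_le_one, min_le_right _ _⟩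

lemma measureReal_triangleEvent_irgEdge_le (hμ : 0 < μ) (hw : ∀ i, 0 < w i) (a b c : Fin n) :
    (graphMeasure (irgEdge μ w)).real (triangleEvent a b c) ≤
      w a * w b / (μ * n) * (w b * w c / (μ * n)) * (w c * w a / (μ * n)) := by
  have ha := (hw a).le
  have hb := (hw b).le
  have hc := (hw c).le
  by_cases habc : a ≠ b ∧ b ≠ c ∧ c ≠ a
  · have h := fun i j => (irgEdge_mem_Icc hμ.le hw i j).1
    have h' : ∀ i j, irgEdge μ w i j ≤ w i * w j / (μ * n) := fun _ _ => min_le_left _ _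
    rw [measureReal_triangleEvent (irgEdge_comm μ w) (irgEdge_mem_Icc hμ.le hw) habc.1 habc.2.1
      habc.2.2]
    exact mul_le_mul (mul_le_mul (h' a b) (h' b c) (h _ _) (by positivity)) (h' c a) (h _ _)
      (by positivity)
  · have hempty : triangleEvent a b c = ∅ := Set.eq_empty_of_forall_notMem fun G hG =>
      habc ⟨hG.1.ne, hG.2.1.ne, hG.2.2.ne⟩
    rw [hempty, measureReal_empty]
    positivity

lemma integral_weightedTriangles_irgEdge_le (hμ : 0 < μ) (hw : ∀ i, 0 < w i) :
    ∫ G, weightedTriangles w G ∂graphMeasure (irgEdge μ w) ≤ ((∑ i, w i) / (μ * n)) ^ 3 := by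
  have := isProbabilityMeasure_graphMeasure (irgEdge_comm μ w) (irgEdge_mem_Icc hμ.le hw)
  calc ∫ G, weightedTriangles w G ∂graphMeasure (irgEdge μ w)
      = ∑ a, ∑ b, ∑ c, 1 / (w a * w b * w c) *
          (graphMeasure (irgEdge μ w)).real (triangleEvent a b c) := by
        simp only [weightedTriangles_eq_sum_indicator]
        simp_rw [integral_finsetSum Finset.univ fun _ _ => Integrable.of_finite, integral_const_mul,
          integral_indicator_one (MeasurableSet.of_discrete (s := triangleEvent _ _ _))]
    _ ≤ ∑ a, ∑ b, ∑ c, w a / (μ * n) * (w b / (μ * n)) * (w c / (μ * n)) := by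
        refine Finset.sum_le_sum fun a _ => Finset.sum_le_sum fun b _ =>
          Finset.sum_le_sum fun c _ => ?_
        have ha := hw a
        have hb := hw b
        have hc := hw c
        have hn : (0 : ℝ) < n := Nat.cast_pos.2 a.pos
        refine (mul_le_mul_of_nonneg_left (measureReal_triangleEvent_irgEdge_le hμ hw a b c)
          (by positivity)).trans_eq ?_
        field_simp
    _ = ((∑ i, w i) / (μ * n)) ^ 3 := by
        simp only [pow_three', Finset.sum_div, ← Finset.mul_sum, ← Finset.sum_mul]

lemma nullProb_le_weightedTriangles_le (hμ : 0 < μ) (hw : ∀ i, 0 < w i) {t : ℝ} (ht : 0 < t) :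
    nullProb μ w {G | t ≤ weightedTriangles w G} ≤ ((∑ i, w i) / (μ * n)) ^ 3 / t := by
  have := isProbabilityMeasure_graphMeasure (irgEdge_comm μ w) (irgEdge_mem_Icc hμ.le hw)
  rw [nullProb, graphProb_eq_measureReal (irgEdge_mem_Icc hμ.le hw), le_div_iff₀' ht]
  exact (mul_meas_ge_le_integral_of_nonneg (.of_forall fun G => weightedTriangles_nonneg hw G)
    .of_finite t).trans (integral_weightedTriangles_irgEdge_le hμ hw)

lemma tendsto_nullProb_le_weightedTriangles (hμ : 0 < μ) {w : (n : ℕ) → Fin n → ℝ}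
    (hw : ∀ n i, 0 < w n i) (hsum : (fun n => ∑ i, w n i) =O[atTop] fun n => (n : ℝ)) {f : ℕ → ℝ}
    (hf : Tendsto f atTop atTop) :
    Tendsto (fun n => nullProb μ (w n) {G | f n ≤ weightedTriangles (w n) G}) atTop (𝓝 0) := by
  obtain ⟨K, hK⟩ := hsum.bound
  refine tendsto_of_tendsto_of_tendsto_of_le_of_le' tendsto_const_nhds
    (hf.const_div_atTop ((K / μ) ^ 3))
    (.of_forall fun n => graphProb_nonneg (irgEdge_mem_Icc hμ.le (hw n)) _) ?_
  filter_upwards [hK, hf.eventually_gt_atTop 0, eventually_gt_atTop 0] with n hn hfn hn0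
  have : (0 : ℝ) < n := Nat.cast_pos.2 hn0
  have hsum0 : 0 ≤ ∑ i, w n i := Finset.sum_nonneg fun i _ => (hw n i).le
  have hmean : (∑ i, w n i) / (μ * n) ≤ K / μ := by
    rw [div_le_div_iff₀ (by positivity) hμ]
    have h := (le_abs_self _).trans hn
    rw [Real.norm_natCast] at h
    nlinarith
  refine (nullProb_le_weightedTriangles_le hμ (hw n) hfn).trans ?_
  gcongr

end Null

/-! ### The alternative hypothesis -/

section AltEdge

variable {d : ℕ} {γ : ℝ≥0∞} {μ : ℝ} {n k : ℕ} {w : Fin n → ℝ} {x : Fin k → UnitAddTorus (Fin d)}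

lemma kernel_mem_Icc (γ : ℝ≥0∞) {s r : ℝ} (hs : 0 ≤ s) (hr : 0 ≤ r) :
    kernel γ s r ∈ Set.Icc 0 1 := by
  have h : 0 ≤ min (s / r) 1 := le_min (div_nonneg hs hr) zero_le_one
  unfold kernel
  split_ifs
  · simp
  · simp
  · simp
  · exact ⟨Real.rpow_nonneg h _,
      Real.rpow_le_one h (min_le_right _ _) ENNReal.toReal_nonneg⟩

lemma kernel_eq_one (γ : ℝ≥0∞) {s r : ℝ} (hr : 0 ≤ r) (hrs : r ≤ s) : kernel γ s r = 1 := by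
  unfold kernel
  split_ifs with h
  · rfl
  · rfl
  · rw [min_eq_right ((one_le_div (hr.lt_of_ne' h)).2 hrs), Real.one_rpow]

lemma corrConst_nonneg (d : ℕ) (γ : ℝ≥0∞) : 0 ≤ corrConst d γ := by
  unfold corrConst
  positivity

lemma altEdge_comm (i j : Fin n) : altEdge d γ μ k w x i j = altEdge d γ μ k w x j i := by
  unfold altEdge
  by_cases h : i.val < k ∧ j.val < k
  · rw [dif_pos h, dif_pos h.symm, norm_sub_rev, mul_comm (w i)]
  · rw [dif_neg h, dif_neg (mt And.symm h), irgEdge_comm]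

lemma altEdge_mem_Icc (hμ : 0 ≤ μ) (hw : ∀ i, 0 < w i) (i j : Fin n) :
    altEdge d γ μ k w x i j ∈ Set.Icc 0 1 := by
  have hC := corrConst_nonneg d γ
  refine unitInterval.mul_mem (unitInterval.div_mem zero_le_one (by positivity) (by linarith)) ?_
  split_ifs
  · exact kernel_mem_Icc γ (mul_pos (hw i) (hw j)).le (by positivity)
  · exact irgEdge_mem_Icc hμ hw i j

lemma altEdge_castLE (hk : k ≤ n) (hμ : 0 ≤ μ) {a b : Fin k}
    (h : μ * k * ‖x a - x b‖ ^ d ≤ w (Fin.castLE hk a) * w (Fin.castLE hk b)) :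
    altEdge d γ μ k w x (Fin.castLE hk a) (Fin.castLE hk b) = 1 / (1 + corrConst d γ) := by
  unfold altEdge
  rw [dif_pos (by simp)]
  simp only [Fin.val_castLE, Fin.eta]
  rw [kernel_eq_one γ (by positivity) h, mul_one]

end AltEdge

section OccupiedCells

variable {ι κ δ : Type*} [Fintype δ] {L : ℕ}

open Classical in
/-- The cells that contain a point `x a`, `a ∈ S g`, of each group `S g`. -/
noncomputable def occupiedCells (L : ℕ) (S : κ → Finset ι) (x : ι → UnitAddTorus δ) :
    Finset (δ → Fin L) :=
  {j | x ∈ ⋂ g, hitSet (S g) (torusCell L j)}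

variable {S : κ → Finset ι} {m : ℕ}

lemma mem_occupiedCells {x : ι → UnitAddTorus δ} {j : δ → Fin L} :
    j ∈ occupiedCells L S x ↔ ∀ g, ∃ a ∈ S g, x a ∈ torusCell L j := by
  simp only [occupiedCells, Finset.mem_filter_univ, Set.mem_iInter]
  rfl

lemma measurable_card_occupiedCells [Finite κ] :
    Measurable fun x : ι → UnitAddTorus δ => (occupiedCells L S x).card := by
  classical
  simp only [occupiedCells, Finset.card_filter]
  exact Finset.measurable_fun_sum _ fun j _ => .ite
    (.iInter fun g => measurableSet_hitSet _ (measurableSet_torusCell j)) measurable_const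
    measurable_const

variable [Fintype ι] [Fintype κ]

lemma one_sub_exp_pow_le_measureReal_iInter_hitSet (hS : Pairwise (Function.onFun Disjoint S))
    (hm : ∀ g, m ≤ (S g).card) (hL : 0 < L) (j : δ → Fin L) :
    (1 - Real.exp (-(m * (1 / (2 * L)) ^ Fintype.card δ))) ^ Fintype.card κ ≤
      volume.real (⋂ g, hitSet (S g) (torusCell L j)) := by
  set v : ℝ := (1 / (2 * L)) ^ Fintype.card δ
  have hv : v = volume.real (torusCell L j) := (volume_torusCell hL j).symm
  have hv1 : 0 ≤ 1 - v := sub_nonneg.2 (hv ▸ measureReal_le_one)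
  rw [volume_pi, measureReal_iInter_hitSet hS (measurableSet_torusCell j), ← hv]
  have hg : ∀ g, 1 - Real.exp (-(m * v)) ≤ 1 - (1 - v) ^ (S g).card := fun g => by
    refine sub_le_sub_left ?_ 1
    calc (1 - v) ^ (S g).card ≤ (1 - v) ^ m :=
          pow_le_pow_of_le_one hv1 (sub_le_self _ (by positivity)) (hm g)
      _ ≤ Real.exp (-v) ^ m := pow_le_pow_left₀ hv1 (Real.one_sub_le_exp_neg v) m
      _ = Real.exp (-(m * v)) := by rw [← Real.exp_nat_mul, mul_neg]
  calc _ = ∏ _g : κ, (1 - Real.exp (-(m * v))) := by rw [Finset.prod_const, Finset.card_univ]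
    _ ≤ _ := Finset.prod_le_prod
      (fun _ _ => sub_nonneg.2 (Real.exp_le_one_iff.2 (neg_nonpos.2 (by positivity))))
      fun g _ => hg g

lemma measureReal_card_occupiedCells_lt_le (hS : Pairwise (Function.onFun Disjoint S))
    (hm : ∀ g, m ≤ (S g).card) (hL : 0 < L) {e : ℝ} (he : 0 < e)
    (hem : e ≤ L ^ Fintype.card δ *
      (1 - Real.exp (-(m * (1 / (2 * L)) ^ Fintype.card δ))) ^ Fintype.card κ) :
    volume.real {x : ι → UnitAddTorus δ | ((occupiedCells L S x).card : ℝ) < e / 2} ≤ 4 / e := by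
  classical
  refine measureReal_card_lt_half_le (J := Finset.univ)
    (A := fun j => ⋂ g, hitSet (S g) (torusCell L j))
    (fun j _ => .iInter fun g => measurableSet_hitSet _ (measurableSet_torusCell j))
    (fun i _ j _ hij => measureReal_iInter_hitSet_inter_le hS (measurableSet_torusCell i)
      (measurableSet_torusCell j) (pairwise_disjoint_torusCell hij)) he ?_
  calc e ≤ ∑ _j : δ → Fin L,
        (1 - Real.exp (-(m * (1 / (2 * L)) ^ Fintype.card δ))) ^ Fintype.card κ := by
        simpa using hem
    _ ≤ _ := Finset.sum_le_sum fun j _ => one_sub_exp_pow_le_measureReal_iInter_hitSet hS hm hL j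

end OccupiedCells

section Alternative

variable {d : ℕ} {γ : ℝ≥0∞} {μ w₀ M t e : ℝ} {n k L : ℕ} {w : Fin n → ℝ}
  {S : Fin 3 → Finset (Fin k)}

lemma graphProb_altEdge_weightedTriangles_lt_le (hk : k ≤ n) (hμ : 0 ≤ μ) (hw : ∀ i, 0 < w i)
    (hw₀ : 0 ≤ w₀) (hS : Pairwise (Function.onFun Disjoint S))
    (hSw : ∀ g, ∀ a ∈ S g, w₀ ≤ w (Fin.castLE hk a) ∧ w (Fin.castLE hk a) ≤ M)
    (hL : μ * k * (1 / (2 * L)) ^ d ≤ w₀ ^ 2) {x : Fin k → UnitAddTorus (Fin d)} (he : 0 < e)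
    (hx : e / 2 ≤ (occupiedCells L S x).card)
    (ht : M ^ 3 * t ≤ e * (1 / (1 + corrConst d γ)) ^ 3 / 4) :
    graphProb (altEdge d γ μ k w x) {G | weightedTriangles w G < t} ≤
      8 / (e * (1 / (1 + corrConst d γ)) ^ 3) := by
  set J := occupiedCells L S x
  have hC := corrConst_nonneg d γ
  choose a haS hax using fun j : J => mem_occupiedCells.1 j.2
  have ha : Function.Injective fun i : J × Fin 3 => a i.1 i.2 := by
    rintro ⟨j, g⟩ ⟨j', g'⟩ (h : a j g = a j' g')
    have hg : g = g' := hS.eq (Finset.not_disjoint_iff.2 ⟨_, haS j g, h ▸ haS j' g'⟩)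
    have hj : j.1 = j'.1 :=
      pairwise_disjoint_torusCell.eq (Set.not_disjoint_iff.2 ⟨_, hax j g, h ▸ hax j' g'⟩)
    rw [hg, Subtype.ext hj]
  have hclose : ∀ j g h, altEdge d γ μ k w x (Fin.castLE hk (a j g)) (Fin.castLE hk (a j h)) =
      1 / (1 + corrConst d γ) := fun j g h => by
    refine altEdge_castLE hk hμ ?_
    calc μ * k * ‖x (a j g) - x (a j h)‖ ^ d ≤ μ * k * (1 / (2 * L)) ^ d := by
          gcongr
          exact norm_sub_le_of_mem_torusCell (hax j g) (hax j h)
      _ ≤ w₀ * w₀ := hL.trans_eq (sq w₀)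
      _ ≤ _ := mul_le_mul (hSw g _ (haS j g)).1 (hSw h _ (haS j h)).1 hw₀ (hw _).le
  have hJ : 0 < (J.card : ℝ) := (half_pos he).trans_le hx
  have : Nonempty J := (Finset.card_pos.1 (Nat.cast_pos.1 hJ)).to_subtype
  refine (graphProb_weightedTriangles_lt_le (M := M) altEdge_comm (altEdge_mem_Icc hμ hw) hw
    (v := fun i => Fin.castLE hk (a i.1 i.2)) ((Fin.castLE_injective hk).comp ha)
    (fun i => (hSw _ _ (haS i.1 i.2)).2) (fun j g h _ => hclose j g h) (by positivity)
    (ht.trans ?_)).trans ?_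
  all_goals rw [Fintype.card_coe]
  · have : 0 ≤ (1 / (1 + corrConst d γ)) ^ 3 := by positivity
    nlinarith
  · rw [div_le_div_iff₀ (by positivity) (by positivity)]
    have : 0 ≤ (1 / (1 + corrConst d γ)) ^ 3 := by positivity
    nlinarith

lemma altProb_weightedTriangles_lt_le (hk : k ≤ n) (hμ : 0 ≤ μ) (hw : ∀ i, 0 < w i)
    (hw₀ : 0 ≤ w₀) (hS : Pairwise (Function.onFun Disjoint S))
    (hSw : ∀ g, ∀ a ∈ S g, w₀ ≤ w (Fin.castLE hk a) ∧ w (Fin.castLE hk a) ≤ M) {m : ℕ}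
    (hm : ∀ g, m ≤ (S g).card) (hL₀ : 0 < L) (hL : μ * k * (1 / (2 * L)) ^ d ≤ w₀ ^ 2)
    (he : 0 < e) (hem : e ≤ L ^ d * (1 - Real.exp (-(m * (1 / (2 * L)) ^ d))) ^ 3)
    (ht : M ^ 3 * t ≤ e * (1 / (1 + corrConst d γ)) ^ 3 / 4) :
    altProb d γ μ k w {G | weightedTriangles w G < t} ≤
      4 / e + 8 / (e * (1 / (1 + corrConst d γ)) ^ 3) := by
  have := corrConst_nonneg d γ
  have : IsProbabilityMeasure (volume : Measure (Fin k → UnitAddTorus (Fin d))) :=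
    ⟨by simp [volume_pi (α := fun _ : Fin k => UnitAddTorus (Fin d))]⟩
  set B : Set (Fin k → UnitAddTorus (Fin d)) := {x | ((occupiedCells L S x).card : ℝ) < e / 2}
  set D : ℝ := 8 / (e * (1 / (1 + corrConst d γ)) ^ 3)
  have hB : MeasurableSet B :=
    measurableSet_lt (measurable_from_top.comp measurable_card_occupiedCells) measurable_const
  have hBint : Integrable (B.indicator (1 : (Fin k → UnitAddTorus (Fin d)) → ℝ)) :=
    (integrable_const (1 : ℝ)).indicator hB
  calc altProb d γ μ k w {G | weightedTriangles w G < t}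
      ≤ ∫ x, (B.indicator 1 x + D) := by
        refine integral_mono_of_nonneg
          (.of_forall fun x => graphProb_nonneg (altEdge_mem_Icc hμ hw) _)
          (hBint.add (integrable_const D)) (.of_forall fun x => ?_)
        beta_reduce
        by_cases hx : x ∈ B
        · rw [Set.indicator_of_mem hx]
          exact (graphProb_le_one altEdge_comm (altEdge_mem_Icc hμ hw) _).trans
            (le_add_of_nonneg_right (by positivity))
        · rw [Set.indicator_of_notMem hx, zero_add]
          exact graphProb_altEdge_weightedTriangles_lt_le hk hμ hw hw₀ hS hSw hL he
            (not_lt.1 hx) ht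
    _ = volume.real B + D := by
        rw [integral_add hBint (integrable_const D), integral_indicator_one hB, integral_const,
          probReal_univ, one_smul]
    _ ≤ 4 / e + D := by
        gcongr
        exact measureReal_card_occupiedCells_lt_le hS hm hL₀ he (by simpa using hem)

lemma exists_nat_pow_mem_Icc {d : ℕ} (hd : d ≠ 0) {s : ℝ} (hs : 1 ≤ s) :
    ∃ L : ℕ, (L : ℝ) ^ d ∈ Set.Icc s (2 ^ d * s) := by
  have hroot : 1 ≤ s ^ (d⁻¹ : ℝ) := Real.one_le_rpow hs (by positivity)
  have hpow : (s ^ (d⁻¹ : ℝ)) ^ d = s := Real.rpow_inv_natCast_pow (by positivity) hd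
  have hceil := Nat.ceil_lt_add_one (zero_le_one.trans hroot)
  refine ⟨⌈s ^ (d⁻¹ : ℝ)⌉₊, ?_, ?_⟩
  · calc s = (s ^ (d⁻¹ : ℝ)) ^ d := hpow.symm
      _ ≤ _ := by
        gcongr
        exact Nat.le_ceil _
  · calc (⌈s ^ (d⁻¹ : ℝ)⌉₊ : ℝ) ^ d ≤ (2 * s ^ (d⁻¹ : ℝ)) ^ d := by
          gcongr
          linarith
      _ = 2 ^ d * s := by rw [mul_pow, hpow]

lemma exists_pairwise_disjoint_subsets_card_eq {α : Type*} {S : Finset α} {r m : ℕ}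
    (h : r * m ≤ S.card) :
    ∃ T : Fin r → Finset α, Pairwise (Function.onFun Disjoint T) ∧
      (∀ g, T g ⊆ S) ∧ ∀ g, (T g).card = m := by
  obtain ⟨φ⟩ : Nonempty (Fin r × Fin m ↪ S) :=
    Function.Embedding.nonempty_of_card_le (by simpa using h)
  have hφ : Function.Injective fun a => (φ a : α) := Subtype.val_injective.comp φ.injective
  refine ⟨fun g => Finset.univ.map ⟨fun a => φ (g, a), hφ.comp (Prod.mk_right_injective g)⟩,
    fun g h hgh => ?_, fun g => ?_, fun g => by simp⟩
  · simp only [Function.onFun, Finset.disjoint_left, Finset.mem_map, Finset.mem_univ, true_and,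
      Function.Embedding.coeFn_mk]
    rintro _ ⟨a, rfl⟩ ⟨b, hab⟩
    exact hgh (congrArg Prod.fst (hφ hab)).symm
  · intro a ha
    obtain ⟨b, -, rfl⟩ := Finset.mem_map.1 ha
    exact (φ (g, b)).2

lemma community_eq_map {n k : ℕ} (hk : k ≤ n) :
    community n k = Finset.univ.map (Fin.castLEEmb hk) := by
  ext i
  simp only [community, Finset.mem_filter_univ, Finset.mem_map, Finset.mem_univ, true_and,
    Fin.castLEEmb_apply]
  exact ⟨fun h => ⟨⟨i, h⟩, rfl⟩, by rintro ⟨a, rfl⟩; simp⟩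

/-- If the torus is divided into about `s k` cells and each group consists of at least `c k / 6`
uniform points, then the expected number of cells that contain a point of each of three groups is
at least `occupancyRate d s c * k`. -/
noncomputable def occupancyRate (d : ℕ) (s c : ℝ) : ℝ :=
  s * (1 - Real.exp (-(c / (6 * 4 ^ d * s)))) ^ 3

lemma occupancyRate_pos {s c : ℝ} (hs : 0 < s) (hc : 0 < c) : 0 < occupancyRate d s c := by
  have : 0 < 1 - Real.exp (-(c / (6 * 4 ^ d * s))) :=
    sub_pos.2 (Real.exp_lt_one_iff.2 (neg_neg_of_pos (by positivity)))
  unfold occupancyRate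
  positivity

lemma exists_grid {d m : ℕ} (hd : d ≠ 0) {s c y : ℝ} (hs : 0 < s) (hc : 0 ≤ c) (hy : 1 ≤ s * y)
    (hm : c * y / 6 ≤ m) :
    ∃ L : ℕ, 0 < L ∧ s * y * (1 / (2 * L)) ^ d ≤ 1 ∧
      occupancyRate d s c * y ≤ L ^ d * (1 - Real.exp (-(m * (1 / (2 * L)) ^ d))) ^ 3 := by
  obtain ⟨L, hLs, hLs'⟩ := exists_nat_pow_mem_Icc hd hy
  have hLd : (0 : ℝ) < L ^ d := zero_lt_one.trans_le (hy.trans hLs)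
  have hy₀ : 0 < y := pos_of_mul_pos_right (zero_lt_one.trans_le hy) hs.le
  have hcell : (1 / (2 * L : ℝ)) ^ d = 1 / (2 ^ d * L ^ d) := by rw [div_pow, one_pow, mul_pow]
  refine ⟨L, Nat.pos_of_ne_zero fun h => hLd.ne' (by simp [h, hd]), ?_, ?_⟩
  · rw [hcell, mul_one_div, div_le_one (by positivity)]
    exact hLs.trans (le_mul_of_one_le_left hLd.le (one_le_pow₀ one_le_two))
  · have hexp : c / (6 * 4 ^ d * s) ≤ m * (1 / (2 ^ d * L ^ d)) :=
      calc c / (6 * 4 ^ d * s) = c * y / 6 * (1 / (2 ^ d * (2 ^ d * (s * y)))) := by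
            rw [← mul_assoc (2 ^ d), ← mul_pow]
            norm_num
            field_simp
        _ ≤ m * (1 / (2 ^ d * L ^ d)) := by gcongr
    have : 0 ≤ 1 - Real.exp (-(c / (6 * 4 ^ d * s))) :=
      sub_nonneg.2 (Real.exp_le_one_iff.2 (neg_nonpos.2 (by positivity)))
    rw [hcell, occupancyRate, mul_right_comm]
    gcongr

lemma altProb_weightedTriangles_lt_le_of_card {c : ℝ} (hd : d ≠ 0) (hk : k ≤ n) (hμ : 0 < μ)
    (hw : ∀ i, 0 < w i) (hw₀ : 0 < w₀) (hc : 0 < c) (hk₁ : 1 ≤ μ / w₀ ^ 2 * k) (hk₂ : 4 ≤ c * k)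
    (hcard : c * k ≤ (Finset.univ.filter fun a : Fin k =>
      w₀ ≤ w (Fin.castLE hk a) ∧ w (Fin.castLE hk a) ≤ M).card)
    (he : e = occupancyRate d (μ / w₀ ^ 2) c * k)
    (ht : M ^ 3 * t ≤ e * (1 / (1 + corrConst d γ)) ^ 3 / 4) :
    altProb d γ μ k w {G | weightedTriangles w G < t} ≤
      4 / e + 8 / (e * (1 / (1 + corrConst d γ)) ^ 3) := by
  have hs : 0 < μ / w₀ ^ 2 := by positivity
  have hk₀ : (0 : ℝ) < k := pos_of_mul_pos_right (by linarith) hc.le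
  set N := (Finset.univ.filter fun a : Fin k =>
      w₀ ≤ w (Fin.castLE hk a) ∧ w (Fin.castLE hk a) ≤ M).card
  have hm : c * k / 6 ≤ (N / 3 : ℕ) := by
    have hN : 4 ≤ N := by exact_mod_cast hk₂.trans hcard
    have : (N : ℝ) ≤ 6 * (N / 3 : ℕ) := by exact_mod_cast (by lia : N ≤ 6 * (N / 3))
    linarith
  obtain ⟨S, hS, hSw, hSm⟩ := exists_pairwise_disjoint_subsets_card_eq (Nat.mul_div_le N 3)
  obtain ⟨L, hL₀, hL, hem⟩ := exists_grid hd hs hc.le hk₁ hm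
  refine altProb_weightedTriangles_lt_le hk hμ.le hw hw₀.le hS
    (fun g a ha => by simpa using hSw g ha) (fun g => (hSm g).ge) hL₀ ?_
    (he ▸ mul_pos (occupancyRate_pos hs hc) hk₀) (he ▸ hem) ht
  calc μ * k * (1 / (2 * L)) ^ d = μ / w₀ ^ 2 * k * (1 / (2 * L)) ^ d * w₀ ^ 2 := by field_simp
    _ ≤ w₀ ^ 2 := mul_le_of_le_one_left (by positivity) hL

lemma tendsto_altProb_weightedTriangles_lt {c : ℝ} (hd : d ≠ 0) (γ : ℝ≥0∞) (hμ : 0 < μ)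
    (hw₀ : 0 < w₀) (hc : 0 < c) {k : ℕ → ℕ} (hk : ∀ n, k n ≤ n) {w : (n : ℕ) → Fin n → ℝ}
    (hw : ∀ n i, 0 < w n i)
    (hcard : ∀ᶠ n in atTop, c * k n ≤
      ((community n (k n)).filter fun i => w₀ ≤ w n i ∧ w n i ≤ M).card)
    (hk_lim : Tendsto (fun n => (k n : ℝ)) atTop atTop) {f : ℕ → ℝ}
    (hf : f =o[atTop] fun n => (k n : ℝ)) :
    Tendsto (fun n => altProb d γ μ (k n) (w n) {G | weightedTriangles (w n) G < f n}) atTop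
      (𝓝 0) := by
  set s := μ / w₀ ^ 2
  set q := (1 / (1 + corrConst d γ)) ^ 3
  have hs : 0 < s := by positivity
  have hq : 0 < q := by have := corrConst_nonneg d γ; positivity
  have hr := occupancyRate_pos (d := d) hs hc
  have he := hk_lim.const_mul_atTop hr
  refine squeeze_zero' (.of_forall fun n => integral_nonneg fun x =>
    graphProb_nonneg (altEdge_mem_Icc hμ.le (hw n)) _) ?_
    (by simpa using (he.const_div_atTop 4).add ((he.atTop_mul_const hq).const_div_atTop 8))
  filter_upwards [hcard, (hk_lim.const_mul_atTop hs).eventually_ge_atTop 1,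
    (hk_lim.const_mul_atTop hc).eventually_ge_atTop 4,
    (hf.const_mul_left (M ^ 3)).bound (by positivity : 0 < occupancyRate d s c * q / 4)]
    with n hn hn₁ hn₂ hn₃
  refine altProb_weightedTriangles_lt_le_of_card (M := M) hd (hk n) hμ (hw n) hw₀ hc hn₁ hn₂
    ?_ rfl ?_
  · rwa [community_eq_map (hk n), Finset.filter_map, Finset.card_map] at hn
  · refine (le_abs_self _).trans (hn₃.trans_eq ?_)
    rw [Real.norm_natCast]
    ring

end Alternative

/-! ### Power-law weights -/

section Weights

variable {τ C w₀ : ℝ}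

lemma meanWeight_pos (hτ : 2 < τ) (hw₀ : 0 < w₀) : 0 < meanWeight τ w₀ :=
  mul_pos hw₀ (div_pos (by linarith) (by linarith))

lemma card_mul_one_sub_empiricalCDF {n : ℕ} (w : Fin n → ℝ) (S : Finset (Fin n)) (x : ℝ) :
    S.card * (1 - empiricalCDF w S x) = (S.filter fun i => x < w i).card := by
  rcases S.eq_empty_or_nonempty with rfl | hS
  · simp
  · have hS₀ : (S.card : ℝ) ≠ 0 := Nat.cast_ne_zero.2 hS.card_pos.ne'
    have h := Finset.card_filter_add_card_filter_not (s := S) (fun i => w i ≤ x)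
    simp only [not_le] at h
    rw [empiricalCDF, mul_one_sub, mul_div_cancel₀ _ hS₀, ← h, Nat.cast_add, add_sub_cancel_left]

lemma integrableOn_indicator_Iio (a b : ℝ) :
    IntegrableOn ((Set.Iio b).indicator (1 : ℝ → ℝ)) (Set.Ioi a) := by
  rw [IntegrableOn, integrable_indicator_iff measurableSet_Iio, IntegrableOn,
    Measure.restrict_restrict measurableSet_Iio, Set.inter_comm, Set.Ioi_inter_Iio]
  exact integrableOn_const (by simp)

lemma le_add_setIntegral_indicator_Iio (a b : ℝ) :
    b ≤ a + ∫ x in Set.Ioi a, (Set.Iio b).indicator 1 x := by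
  rw [setIntegral_indicator measurableSet_Iio, Set.Ioi_inter_Iio]
  simp only [Pi.one_apply, setIntegral_const, smul_eq_mul, mul_one, Real.volume_real_Ioo]
  linarith [le_max_left (b - a) 0]

lemma sum_indicator_Iio_le_of_tail {n : ℕ} (hC : 0 ≤ C) {w : Fin n → ℝ} {b x : ℝ} (hx : 0 ≤ x)
    (htail : x ≤ b → 1 - empiricalCDF w Finset.univ x ≤ C * x ^ (1 - τ)) :
    ∑ i with w i ≤ b, (Set.Iio (w i)).indicator (1 : ℝ → ℝ) x ≤ n * (C * x ^ (1 - τ)) := by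
  rcases le_or_gt x b with hxb | hbx
  · calc ∑ i with w i ≤ b, (Set.Iio (w i)).indicator (1 : ℝ → ℝ) x
        ≤ ∑ i, (Set.Iio (w i)).indicator (1 : ℝ → ℝ) x :=
          Finset.sum_le_sum_of_subset_of_nonneg (Finset.subset_univ _) fun i _ _ =>
            Set.indicator_nonneg (fun _ _ => zero_le_one) x
      _ = n * (1 - empiricalCDF w Finset.univ x) := by
          have := card_mul_one_sub_empiricalCDF w Finset.univ x
          rw [Finset.card_univ, Fintype.card_fin] at this
          simp [this, Set.indicator_apply]
      _ ≤ n * (C * x ^ (1 - τ)) := by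
          gcongr
          exact htail hxb
  · rw [Finset.sum_eq_zero fun i hi => Set.indicator_of_notMem (by simp at hi ⊢; linarith) _]
    positivity

lemma sum_filter_le_le_of_tail {n : ℕ} (hτ : 2 < τ) (hC : 0 ≤ C) (hw₀ : 0 < w₀) {w : Fin n → ℝ}
    {b : ℝ} (htail : ∀ x, w₀ ≤ x → x ≤ b → 1 - empiricalCDF w Finset.univ x ≤ C * x ^ (1 - τ)) :
    ∑ i with w i ≤ b, w i ≤ (w₀ + C * (w₀ ^ (2 - τ) / (τ - 2))) * n := by
  set S : Finset (Fin n) := {i | w i ≤ b}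
  have hint := fun i => integrableOn_indicator_Iio w₀ (w i)
  calc ∑ i ∈ S, w i ≤ ∑ i ∈ S, (w₀ + ∫ x in Set.Ioi w₀, (Set.Iio (w i)).indicator 1 x) :=
        Finset.sum_le_sum fun i _ => le_add_setIntegral_indicator_Iio w₀ (w i)
    _ = S.card * w₀ + ∫ x in Set.Ioi w₀, ∑ i ∈ S, (Set.Iio (w i)).indicator 1 x := by
        rw [integral_finsetSum _ fun i _ => hint i, Finset.sum_add_distrib, Finset.sum_const,
          nsmul_eq_mul]
    _ ≤ n * w₀ + ∫ x in Set.Ioi w₀, n * (C * x ^ (1 - τ)) := by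
        gcongr ?_ * _ + ?_
        · exact_mod_cast card_finset_fin_le S
        · exact setIntegral_mono_on (integrable_finsetSum _ fun i _ => hint i)
            (((integrableOn_Ioi_rpow_of_lt (by linarith) hw₀).const_mul C).const_mul n)
            measurableSet_Ioi fun x hx =>
              sum_indicator_Iio_le_of_tail hC (hw₀.trans hx).le (htail x (le_of_lt hx))
    _ = (w₀ + C * (w₀ ^ (2 - τ) / (τ - 2))) * n := by
        rw [integral_const_mul, integral_const_mul, integral_Ioi_rpow_of_lt (by linarith) hw₀,
          show 1 - τ + 1 = 2 - τ by ring, neg_div, ← div_neg, neg_sub]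
        ring

lemma isBigO_sum_weights (hτ : 2 < τ) (hC : 0 < C) (hw₀ : 0 < w₀) {w : (n : ℕ) → Fin n → ℝ}
    (hw : ∀ n i, 0 < w n i) (hw₁ : PowerLawWeights τ C w₀ w)
    (hexc : (fun n => excessWeight τ (w n)) =O[atTop] fun n => (n : ℝ)) :
    (fun n => ∑ i, w n i) =O[atTop] fun n => (n : ℝ) := by
  have hbulk : (fun n => ∑ i with w n i ≤ cutoff τ n, w n i) =O[atTop] fun n => (n : ℝ) := by
    refine .of_bound (w₀ + 2 * C * (w₀ ^ (2 - τ) / (τ - 2))) ?_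
    filter_upwards [hw₁ 1 one_pos] with n hn
    rw [Real.norm_natCast, Real.norm_of_nonneg (Finset.sum_nonneg fun i _ => (hw n i).le)]
    exact sum_filter_le_le_of_tail hτ (by positivity) hw₀ fun x hx hx' => by
      linarith [(abs_le.1 (hn x hx hx')).2]
  refine (hbulk.add hexc).congr_left fun n => ?_
  simp only [excessWeight, ← not_le]
  exact Finset.sum_filter_add_sum_filter_not _ _ _

lemma tendsto_cutoff (hτ : 1 < τ) : Tendsto (cutoff τ) atTop atTop := by
  have hs : 0 < 1 / (τ - 1) := one_div_pos.2 (sub_pos.2 hτ)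
  have hlog : Tendsto (fun x : ℝ => Real.log x / x ^ (1 / (τ - 1))) atTop (𝓝[>] 0) :=
    tendsto_nhdsWithin_iff.2 ⟨(isLittleO_log_rpow_atTop hs).tendsto_div_nhds_zero, by
      filter_upwards [eventually_gt_atTop 1] with x hx
      exact div_pos (Real.log_pos hx) (Real.rpow_pos_of_pos (one_pos.trans hx) _)⟩
  exact (hlog.inv_tendsto_nhdsGT_zero.comp tendsto_natCast_atTop_atTop).congr fun m => inv_div _ _

lemma card_filter_le_and_le_ge {n : ℕ} (hτ : 2 < τ) (hC : 0 < C) (hw₀ : 0 < w₀) {w : Fin n → ℝ}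
    {S : Finset (Fin n)} {b : ℝ} (hb : 6 * w₀ ≤ b)
    (htail : ∀ x, w₀ ≤ x → x ≤ b →
      |(1 - empiricalCDF w S x) - C * x ^ (1 - τ)| ≤ 1 / 2 * (C * x ^ (1 - τ))) :
    C * w₀ ^ (1 - τ) / 4 * S.card ≤ (S.filter fun i => w₀ ≤ w i ∧ w i ≤ 6 * w₀).card := by
  have hbelow := (abs_le.1 (htail w₀ le_rfl (by linarith))).1
  have habove := (abs_le.1 (htail (6 * w₀) (by linarith) hb)).2
  have hpow : C * (6 * w₀) ^ (1 - τ) ≤ C * (6⁻¹ * w₀ ^ (1 - τ)) := by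
    rw [Real.mul_rpow (by norm_num) hw₀.le, ← Real.rpow_neg_one]
    gcongr <;> linarith
  have hsplit : S.filter (w₀ < w ·) ⊆
      (S.filter fun i => w₀ ≤ w i ∧ w i ≤ 6 * w₀) ∪ S.filter (6 * w₀ < w ·) := fun i hi => by
    simp only [Finset.mem_union, Finset.mem_filter] at hi ⊢
    grind
  have hcard : ((S.filter (w₀ < w ·)).card : ℝ) ≤
      (S.filter fun i => w₀ ≤ w i ∧ w i ≤ 6 * w₀).card + (S.filter (6 * w₀ < w ·)).card :=
    mod_cast (Finset.card_le_card hsplit).trans (Finset.card_union_le _ _)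
  rw [← card_mul_one_sub_empiricalCDF, ← card_mul_one_sub_empiricalCDF] at hcard
  calc C * w₀ ^ (1 - τ) / 4 * S.card
      ≤ ((1 - empiricalCDF w S w₀) - (1 - empiricalCDF w S (6 * w₀))) * S.card := by
        gcongr
        -- `1/4 = 1/2 - (3/2) / 6`
        linarith
    _ ≤ _ := by linarith

lemma card_community {n k : ℕ} (hk : k ≤ n) : (community n k).card = k := by
  rw [community_eq_map hk, Finset.card_map, Finset.card_univ, Fintype.card_fin]

lemma eventually_card_moderate_ge (hτ : 2 < τ) (hC : 0 < C) (hw₀ : 0 < w₀) {k : ℕ → ℕ}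
    (hk : ∀ n, k n ≤ n) (hk_lim : Tendsto k atTop atTop) {w : (n : ℕ) → Fin n → ℝ}
    (hw₂ : PowerLawCommunityWeights τ C w₀ k w) :
    ∀ᶠ n in atTop, C * w₀ ^ (1 - τ) / 4 * k n ≤
      ((community n (k n)).filter fun i => w₀ ≤ w n i ∧ w n i ≤ 6 * w₀).card := by
  filter_upwards [hw₂ 1 one_pos (1 / 2) one_half_pos,
    ((tendsto_cutoff (one_lt_two.trans hτ)).comp hk_lim).eventually_ge_atTop (6 * w₀)] with n hn hn'
  simpa only [card_community (hk n)] using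
    card_filter_le_and_le_ge hτ hC hw₀ (by simpa using hn') hn

end Weights

lemma tendsto_of_isLittleO_natCast {k : ℕ → ℕ} {f : ℕ → ℝ} (hf : Tendsto f atTop atTop)
    (hfk : f =o[atTop] fun n => (k n : ℝ)) : Tendsto k atTop atTop := by
  refine (tendsto_natCast_atTop_iff (R := ℝ)).1 (tendsto_atTop_mono' _ ?_ hf)
  filter_upwards [hfk.bound one_pos] with n hn
  simpa using (le_abs_self _).trans hn

end GeoCommunity

open GeoCommunity in
theorem theorem3p1_general (d : ℕ) (hd : 1 ≤ d) (γ : ℝ≥0∞) (_hγ : 1 < γ) {μ : ℝ} (hμ : 0 < μ)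
    (k : ℕ → ℕ) (hk : ∀ n, k n ≤ n) (w : (n : ℕ) → Fin n → ℝ) (hw : ∀ n i, 0 < w n i)
    (hsum : (fun n => ∑ i, w n i) =O[atTop] fun n => (n : ℝ)) {c w₀ M : ℝ} (hc : 0 < c)
    (hw₀ : 0 < w₀)
    (hmoderate : ∀ᶠ n in atTop, c * k n ≤
      ((community n (k n)).filter fun i => w₀ ≤ w n i ∧ w n i ≤ M).card)
    (f : ℕ → ℝ) (hf : Tendsto f atTop atTop) (hfk : f =o[atTop] fun n => (k n : ℝ)) :
    AsymptoticallyPowerful d γ μ k w (fun n => weightedTriangleTest (w n) (f n)) := by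
  have hk_lim : Tendsto (fun n => (k n : ℝ)) atTop atTop :=
    tendsto_natCast_atTop_iff.2 (tendsto_of_isLittleO_natCast hf hfk)
  have hreject : ∀ n, {G | weightedTriangleTest (w n) (f n) G = 1} =
      {G | f n ≤ weightedTriangles (w n) G} := fun n => by ext G; simp [weightedTriangleTest]
  have haccept : ∀ n, {G | weightedTriangleTest (w n) (f n) G = 0} =
      {G | weightedTriangles (w n) G < f n} := fun n => by ext G; simp [weightedTriangleTest]
  simpa only [AsymptoticallyPowerful, risk, hreject, haccept, add_zero] using
    (tendsto_nullProb_le_weightedTriangles hμ hw hsum hf).add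
      (tendsto_altProb_weightedTriangles_lt (Nat.one_le_iff_ne_zero.1 hd) γ hμ hw₀ hc hk hw
        hmoderate hk_lim hfk)

theorem theorem3p1 (d : ℕ) (hd : 1 ≤ d) (γ : ℝ≥0∞) (hγ : 1 < γ)
    (τ C w₀ : ℝ) (hτ : 2 < τ) (hτ' : τ < 3) (hC : 0 < C) (hw₀ : 0 < w₀)
    (k : ℕ → ℕ) (hk : ∀ n, k n ≤ n)
    (w : (n : ℕ) → Fin n → ℝ) (hw : ∀ n i, 0 < w n i)
    (hw₁ : GeoCommunity.PowerLawWeights τ C w₀ w)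
    (hw₂ : GeoCommunity.PowerLawCommunityWeights τ C w₀ k w)
    (hexc : (fun n => GeoCommunity.excessWeight τ (w n)) =O[atTop] (fun n => (n : ℝ)))
    (f : ℕ → ℝ) (hf : Tendsto f atTop atTop)
    (hfk : f =o[atTop] (fun n => (k n : ℝ))) :
    GeoCommunity.AsymptoticallyPowerful d γ (GeoCommunity.meanWeight τ w₀) k w
      (fun n => GeoCommunity.weightedTriangleTest (w n) (f n)) :=
  theorem3p1_general d hd γ hγ (GeoCommunity.meanWeight_pos hτ hw₀) k hk w hw
    (GeoCommunity.isBigO_sum_weights hτ hC hw₀ hw hw₁ hexc) (by positivity) hw₀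
    (GeoCommunity.eventually_card_moderate_ge hτ hC hw₀ hk
      (GeoCommunity.tendsto_of_isLittleO_natCast hf hfk) hw₂) f hf hfk
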